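/- Let $\mathbb K\in\{\mathbb R,\mathbb C\}$, let $(\Omega,\Sigma,\mu)$ be an arbitrary (positive) measure space, let $n\ge 1$ be an integer and $p=\frac{2n}{2n-1}$. For normed spaces $X,Y$ over $\mathbb K$ let $X\widehat\otimes_\pi Y$ be the completion of the algebraic tensor product $X\otimes Y$ under the projective norm $\|z\|_\pi=\inf\{\sum_i\|x_i\|\|y_i\| : z=\sum_i x_i\otimes y_i \text{ (finite sums)}\}$, and let $\operatorname{INA}_\pi(X\widehat\otimes_\pi Y)$ be the set of all $u\in X\widehat\otimes_\pi Y$ for which there is a finite positive Borel measure $m$ on $B_X\times B_Y$ (the product of the closed unit balls) such that $(x,y)\mapsto x\otimes y$ is $m$-Bochner integrable, $u=\int_{B_X\times B_Y}x\otimes y\,dm(x,y)$ and $m(B_X\times B_Y)=\|u\|_\pi$. A Banach space $X$ over $\mathbb K$ is called LFC if its norm locally depends upon finitely many coordinates: for every $x\in X\setminus\{0\}$ there are $\varepsilon>0$, $N\in\mathbb N$, $x_1^*,\dots,x_N^*\in X^*$ and a continuous $\varphi:\mathbb K^N\to\mathbb R$ with $\|y\|=\varphi(x_1^*(y),\dots,x_N^*(y))$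 whenever $\|y-x\|<\varepsilon$. The Gowers space $G$ is the space of all sequences $(a_k)\in c_0$ of scalars with $$\lim_{N\to\infty}\frac{\sum_{i=1}^N a_i^*}{\sum_{i=1}^N 1/i}=0,\qquad\text{normed by}\qquad \|(a_k)\|=\max_{N\ge1}\frac{\sum_{i=1}^N a_i^*}{\sum_{i=1}^N 1/i},$$ where $(a_i^*)$ is the decreasing rearrangement of $(|a_k|)$. Then $$\operatorname{INA}_\pi(X\widehat\otimes_\pi L_p(\mu))\subseteq X\otimes L_p(\mu)$$ for every LFC Banach space $X$ over $\mathbb K$, and also for $X=G$. The space $c_0$ is LFC, so the inclusion holds in particular for $X=c_0$. -/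

import Mathlib

open MeasureTheory Filter Topology
open scoped TensorProduct ENNReal ZeroAtInfty

noncomputable section

/-! ### The projective tensor product of two normed spaces -/

section Projective

variable (𝕜 : Type*) [RCLike 𝕜] (X : Type*) [NormedAddCommGroup X] [NormedSpace 𝕜 X]
  (Y : Type*) [NormedAddCommGroup Y] [NormedSpace 𝕜 Y]

/-- All the numbers `∑ ‖xᵢ‖ ‖yᵢ‖` given by the finite representations `u = ∑ xᵢ ⊗ yᵢ`. -/
def projReprSums (u : X ⊗[𝕜] Y) : Set ℝ :=
  {r | ∃ s : List (X × Y), (s.map fun q => q.1 ⊗ₜ[𝕜] q.2).sum = u ∧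
    r = (s.map fun q => ‖q.1‖ * ‖q.2‖).sum}

variable {𝕜 X Y} in
theorem projReprSums_nonempty (u : X ⊗[𝕜] Y) : (projReprSums 𝕜 X Y u).Nonempty := by
  induction u using TensorProduct.induction_on with
  | zero => exact ⟨_, [], by simp, rfl⟩
  | tmul x y => exact ⟨_, [(x, y)], by simp, rfl⟩
  | add u v hu hv =>
    obtain ⟨_, s, hs, rfl⟩ := hu
    obtain ⟨_, t, ht, rfl⟩ := hv
    exact ⟨_, s ++ t, by simp [hs, ht], rfl⟩

variable {𝕜 X Y} in
theorem projReprSums_nonneg {u : X ⊗[𝕜] Y} {r : ℝ} (hr : r ∈ projReprSums 𝕜 X Y u) : 0 ≤ r := by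
  obtain ⟨s, -, rfl⟩ := hr
  apply List.sum_nonneg
  intro a ha
  obtain ⟨q, -, rfl⟩ := List.mem_map.1 ha
  positivity

variable {𝕜 X Y} in
theorem projReprSums_bddBelow (u : X ⊗[𝕜] Y) : BddBelow (projReprSums 𝕜 X Y u) :=
  ⟨0, fun _ hr => projReprSums_nonneg hr⟩

/-- The projective norm `‖u‖_π = inf {∑ ‖xᵢ‖ ‖yᵢ‖ : u = ∑ xᵢ ⊗ yᵢ}` on the algebraic tensor
product. -/
def projSeminorm : Seminorm 𝕜 (X ⊗[𝕜] Y) :=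
  Seminorm.ofSMulLE (fun u => sInf (projReprSums 𝕜 X Y u))
    (le_antisymm (csInf_le (projReprSums_bddBelow _) ⟨[], by simp, by simp⟩)
      (le_csInf (projReprSums_nonempty _) fun _ hr => projReprSums_nonneg hr))
    (by
      intro u v
      rw [← sub_le_iff_le_add]
      refine le_csInf (projReprSums_nonempty u) ?_
      rintro _ ⟨s, hs, rfl⟩
      rw [sub_le_iff_le_add, ← sub_le_iff_le_add']
      refine le_csInf (projReprSums_nonempty v) ?_
      rintro _ ⟨t, ht, rfl⟩
      rw [sub_le_iff_le_add']
      exact csInf_le (projReprSums_bddBelow _) ⟨s ++ t, by simp [hs, ht], by simp⟩)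
    (by
      intro c u
      rw [← smul_eq_mul, ← Real.sInf_smul_of_nonneg (norm_nonneg c)]
      refine le_csInf ((projReprSums_nonempty u).smul_set) ?_
      rintro _ ⟨_, ⟨s, hs, rfl⟩, rfl⟩
      refine csInf_le (projReprSums_bddBelow _)
        ⟨s.map fun q => (c • q.1, q.2), ?_, ?_⟩
      · rw [← hs, List.smul_sum, List.map_map, List.map_map]
        rfl
      · simp only [smul_eq_mul, List.map_map]
        rw [← List.sum_map_mul_left]
        congr 1
        apply List.map_congr_left
        intro q _
        simp [norm_smul, mul_assoc])

/-- The algebraic tensor product `X ⊗ Y`, carrying the projective norm. -/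
def AlgProjTensor : Type _ := X ⊗[𝕜] Y

instance : SeminormedAddCommGroup (AlgProjTensor 𝕜 X Y) :=
  (projSeminorm 𝕜 X Y).toAddGroupSeminorm.toSeminormedAddCommGroup

instance : Module 𝕜 (AlgProjTensor 𝕜 X Y) := inferInstanceAs (Module 𝕜 (X ⊗[𝕜] Y))

instance : NormedSpace 𝕜 (AlgProjTensor 𝕜 X Y) where
  norm_smul_le c u := ((projSeminorm 𝕜 X Y).smul' c u).le

/-- The projective tensor product `X ⊗̂_π Y`: the completion of `X ⊗ Y` for the projective norm. -/
def ProjTensor : Type _ := UniformSpace.Completion (AlgProjTensor 𝕜 X Y)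

instance : NormedAddCommGroup (ProjTensor 𝕜 X Y) :=
  inferInstanceAs (NormedAddCommGroup (UniformSpace.Completion (AlgProjTensor 𝕜 X Y)))

instance : NormedSpace 𝕜 (ProjTensor 𝕜 X Y) :=
  inferInstanceAs (NormedSpace 𝕜 (UniformSpace.Completion (AlgProjTensor 𝕜 X Y)))

instance : CompleteSpace (ProjTensor 𝕜 X Y) :=
  inferInstanceAs (CompleteSpace (UniformSpace.Completion (AlgProjTensor 𝕜 X Y)))

/-- The canonical map `X ⊗ Y → X ⊗̂_π Y`. -/
def ProjTensor.ofAlg : X ⊗[𝕜] Y →ₗ[𝕜] ProjTensor 𝕜 X Y :=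
  (UniformSpace.Completion.toComplₗᵢ (𝕜 := 𝕜) (E := AlgProjTensor 𝕜 X Y)).toLinearMap

/-- The copy of the algebraic tensor product `X ⊗ Y` inside `X ⊗̂_π Y`. -/
def algTensors : Set (ProjTensor 𝕜 X Y) := Set.range (ProjTensor.ofAlg 𝕜 X Y)

/-- The elementary tensor `x ⊗ y` as an element of `X ⊗̂_π Y`. -/
def elemTensor (x : X) (y : Y) : ProjTensor 𝕜 X Y := ProjTensor.ofAlg 𝕜 X Y (x ⊗ₜ[𝕜] y)

/-- The set `INA_π(X ⊗̂_π Y)` of the integral projective norm-attaining tensors: those `u` for which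
there is a finite positive measure `m` on the Borel `σ`-algebra of the topological space
`B_X × B_Y` such that `(x, y) ↦ x ⊗ y` is Bochner integrable for `m`, with integral `u`, and
`m (B_X × B_Y) = ‖u‖_π`. (The `σ`-algebra is the Borel one of the product topology; for
nonseparable spaces it may be larger than the product of the two Borel `σ`-algebras.) -/
def INA : Set (ProjTensor 𝕜 X Y) :=
  letI : NormedSpace ℝ (ProjTensor 𝕜 X Y) := NormedSpace.restrictScalars ℝ 𝕜 _
  {u | ∃ m : @Measure (Metric.closedBall (0 : X) 1 × Metric.closedBall (0 : Y) 1) (borel _),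
    IsFiniteMeasure m ∧
    Integrable (fun z => elemTensor 𝕜 X Y (z.1 : X) (z.2 : Y)) m ∧
    u = ∫ z, elemTensor 𝕜 X Y (z.1 : X) (z.2 : Y) ∂m ∧
    m.real Set.univ = ‖u‖}

end Projective

/-! ### Norms locally dependent upon finitely many coordinates -/

/-- The norm of `X` locally depends upon finitely many coordinates. -/
def IsLFC (𝕜 : Type*) [RCLike 𝕜] (X : Type*) [NormedAddCommGroup X] [NormedSpace 𝕜 X] : Prop :=
  ∀ x : X, x ≠ 0 → ∃ ε : ℝ, 0 < ε ∧ ∃ (N : ℕ) (f : Fin N → StrongDual 𝕜 X)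
    (φ : (Fin N → 𝕜) → ℝ), Continuous φ ∧
      ∀ y : X, ‖y - x‖ < ε → ‖y‖ = φ (fun i => f i y)

/-! ### The Gowers space -/

section Gowers

variable {𝕜 : Type*} [RCLike 𝕜]

/-- The decreasing rearrangement of `(|a i|)`, indexed from `0`: its `k`-th term is the least
`t ≥ 0` such that at most `k` of the numbers `|a i|` exceed `t`. -/
def decrRearr (a : ℕ → 𝕜) (k : ℕ) : ℝ :=
  sInf {t : ℝ | 0 ≤ t ∧ {i | t < ‖a i‖}.encard ≤ k}

/-- `a*_1 + ⋯ + a*_N`. -/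
def rearrSum (a : ℕ → 𝕜) (N : ℕ) : ℝ := ∑ i ∈ Finset.range N, decrRearr a i

/-- `1 + 1/2 + ⋯ + 1/N`. -/
def harmSum (N : ℕ) : ℝ := ∑ i ∈ Finset.range N, 1 / ((i : ℝ) + 1)

theorem harmSum_nonneg (N : ℕ) : 0 ≤ harmSum N :=
  Finset.sum_nonneg fun _ _ => by positivity

/-- In a null sequence, every finite set of indices leaves out an index of largest modulus. -/
theorem exists_max_off {a : ℕ → 𝕜} (ha : Tendsto a atTop (𝓝 0)) (A : Finset ℕ) :
    ∃ i, i ∉ A ∧ ∀ j, j ∉ A → ‖a j‖ ≤ ‖a i‖ := by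
  by_cases h : ∃ i, i ∉ A ∧ 0 < ‖a i‖
  · obtain ⟨i₀, hi₀, hpos⟩ := h
    have hev : ∀ᶠ j in atTop, ‖a j‖ < ‖a i₀‖ := by
      have := ha.norm
      rw [norm_zero] at this
      exact this.eventually_lt_const hpos
    obtain ⟨M, hM⟩ := eventually_atTop.1 hev
    have hi₀M : i₀ < M := by
      by_contra hcon
      exact lt_irrefl _ (hM i₀ (not_lt.1 hcon))
    obtain ⟨i, hi, hmax⟩ := Finset.exists_max_image (Finset.range M \ A) (fun j => ‖a j‖)
      ⟨i₀, by simp [hi₀M, hi₀]⟩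
    simp only [Finset.mem_sdiff, Finset.mem_range] at hi hmax
    refine ⟨i, hi.2, fun j hj => ?_⟩
    by_cases hjM : j < M
    · exact hmax j ⟨hjM, hj⟩
    · exact (hM j (not_lt.1 hjM)).le.trans (hmax i₀ ⟨hi₀M, hi₀⟩)
  · push Not at h
    obtain ⟨i, hi⟩ := Infinite.exists_notMem_finset A
    exact ⟨i, hi, fun j hj => (h j hj).trans (norm_nonneg _)⟩

/-- The sum of the first `N` terms of the rearrangement is a sum of `N` largest moduli. -/
theorem exists_top_set {a : ℕ → 𝕜} (ha : Tendsto a atTop (𝓝 0)) (N : ℕ) :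
    ∃ A : Finset ℕ, A.card = N ∧ rearrSum a N = ∑ i ∈ A, ‖a i‖ ∧
      ∃ c, (∀ i ∈ A, c ≤ ‖a i‖) ∧ ∀ j, j ∉ A → ‖a j‖ ≤ c := by
  induction N with
  | zero =>
    obtain ⟨i, -, hi⟩ := exists_max_off ha ∅
    exact ⟨∅, rfl, by simp [rearrSum], ‖a i‖, by simp, hi⟩
  | succ N ih =>
    obtain ⟨A, hcard, hsum, c, hc1, hc2⟩ := ih
    obtain ⟨i, hiA, himax⟩ := exists_max_off ha A
    have hlow : ∀ j ∈ insert i A, ‖a i‖ ≤ ‖a j‖ := by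
      intro j hj
      rcases Finset.mem_insert.1 hj with rfl | hj
      · exact le_rfl
      · exact (hc2 i hiA).trans (hc1 j hj)
    have hcard' : (insert i A).card = N + 1 := by
      rw [Finset.card_insert_of_notMem hiA, hcard]
    have hdr : decrRearr a N = ‖a i‖ := by
      apply le_antisymm
      · refine csInf_le ⟨0, fun t ht => ht.1⟩ ⟨norm_nonneg _, ?_⟩
        have hsub : {j | ‖a i‖ < ‖a j‖} ⊆ (A : Set ℕ) := by
          intro j hj
          by_contra hjA
          exact absurd (himax j hjA) (not_le.2 hj)
        calc _ ≤ (A : Set ℕ).encard := Set.encard_le_encard hsub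
          _ = N := by rw [Set.encard_coe_eq_coe_finsetCard, hcard]
      · refine le_csInf ⟨‖a i‖, norm_nonneg _, ?_⟩ ?_
        · have hsub : {j | ‖a i‖ < ‖a j‖} ⊆ (A : Set ℕ) := by
            intro j hj
            by_contra hjA
            exact absurd (himax j hjA) (not_le.2 hj)
          calc _ ≤ (A : Set ℕ).encard := Set.encard_le_encard hsub
            _ = N := by rw [Set.encard_coe_eq_coe_finsetCard, hcard]
        · rintro t ⟨-, ht⟩
          by_contra hlt
          have hsub : ((insert i A : Finset ℕ) : Set ℕ) ⊆ {j | t < ‖a j‖} := fun j hj =>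
            (not_le.1 hlt).trans_le (hlow j hj)
          have h1 := (Set.encard_le_encard hsub).trans ht
          rw [Set.encard_coe_eq_coe_finsetCard, hcard'] at h1
          have h2 : N + 1 ≤ N := by exact_mod_cast h1
          omega
    refine ⟨insert i A, hcard', ?_, ‖a i‖, hlow, fun j hj => ?_⟩
    · rw [rearrSum, Finset.sum_range_succ, ← rearrSum, hsum, hdr, Finset.sum_insert hiA, add_comm]
    · exact himax j fun hjA => hj (Finset.mem_insert_of_mem hjA)

theorem sum_le_rearrSum {a : ℕ → 𝕜} (ha : Tendsto a atTop (𝓝 0)) (B : Finset ℕ) :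
    ∑ i ∈ B, ‖a i‖ ≤ rearrSum a B.card := by
  obtain ⟨A, hcard, hsum, c, hc1, hc2⟩ := exists_top_set ha B.card
  rw [hsum, ← Finset.sum_sdiff_le_sum_sdiff]
  have h1 : ∑ i ∈ B \ A, ‖a i‖ ≤ (B \ A).card • c :=
    Finset.sum_le_card_nsmul _ _ _ fun i hi => hc2 i (Finset.mem_sdiff.1 hi).2
  have h2 : (A \ B).card • c ≤ ∑ i ∈ A \ B, ‖a i‖ :=
    Finset.card_nsmul_le_sum _ _ _ fun i hi => hc1 i (Finset.mem_sdiff.1 hi).1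
  have h3 : (B \ A).card = (A \ B).card := Finset.card_sdiff_comm hcard.symm
  rw [h3] at h1
  exact h1.trans h2

theorem rearrSum_nonneg (a : ℕ → 𝕜) (N : ℕ) : 0 ≤ rearrSum a N :=
  Finset.sum_nonneg fun _ _ => Real.sInf_nonneg fun _ ht => ht.1

theorem rearrSum_add_le {a b : ℕ → 𝕜} (ha : Tendsto a atTop (𝓝 0)) (hb : Tendsto b atTop (𝓝 0))
    (N : ℕ) : rearrSum (a + b) N ≤ rearrSum a N + rearrSum b N := by
  have hab : Tendsto (a + b) atTop (𝓝 0) := add_zero (0 : 𝕜) ▸ ha.add hb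
  obtain ⟨A, rfl, hsum, -⟩ := exists_top_set hab N
  rw [hsum]
  calc ∑ i ∈ A, ‖(a + b) i‖ ≤ ∑ i ∈ A, (‖a i‖ + ‖b i‖) :=
        Finset.sum_le_sum fun i _ => norm_add_le _ _
    _ = ∑ i ∈ A, ‖a i‖ + ∑ i ∈ A, ‖b i‖ := Finset.sum_add_distrib
    _ ≤ _ := add_le_add (sum_le_rearrSum ha A) (sum_le_rearrSum hb A)

theorem rearrSum_smul {a : ℕ → 𝕜} (ha : Tendsto a atTop (𝓝 0)) (c : 𝕜) (N : ℕ) :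
    rearrSum (c • a) N = ‖c‖ * rearrSum a N := by
  have hca : Tendsto (c • a) atTop (𝓝 0) := smul_zero (A := 𝕜) c ▸ ha.const_smul c
  have key : ∀ A : Finset ℕ, ∑ i ∈ A, ‖(c • a) i‖ = ‖c‖ * ∑ i ∈ A, ‖a i‖ := fun A => by
    simp [Finset.mul_sum]
  apply le_antisymm
  · obtain ⟨A, rfl, hsum, -⟩ := exists_top_set hca N
    rw [hsum, key]
    exact mul_le_mul_of_nonneg_left (sum_le_rearrSum ha A) (norm_nonneg _)
  · obtain ⟨A, rfl, hsum, -⟩ := exists_top_set ha N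
    rw [hsum, ← key]
    exact sum_le_rearrSum hca A

theorem rearrSum_zero (N : ℕ) : rearrSum (0 : ℕ → 𝕜) N = 0 := by
  have := rearrSum_smul (𝕜 := 𝕜) (a := 0) tendsto_const_nhds 0 N
  simpa using this

variable (𝕜) in
/-- The null sequences `a` with `lim_N (a*_1 + ⋯ + a*_N) / (1 + 1/2 + ⋯ + 1/N) = 0`. -/
def gowersSubmodule : Submodule 𝕜 (ℕ → 𝕜) where
  carrier := {a | Tendsto a atTop (𝓝 0) ∧
    Tendsto (fun N => rearrSum a N / harmSum N) atTop (𝓝 0)}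
  zero_mem' := ⟨tendsto_const_nhds, by simp [rearrSum_zero]⟩
  add_mem' := by
    rintro a b ⟨ha, ha'⟩ ⟨hb, hb'⟩
    refine ⟨add_zero (0 : 𝕜) ▸ ha.add hb, ?_⟩
    refine squeeze_zero (fun N => div_nonneg (rearrSum_nonneg _ _) (harmSum_nonneg _))
      (fun N => ?_) (by simpa using ha'.add hb')
    rw [← add_div]
    exact div_le_div_of_nonneg_right (rearrSum_add_le ha hb N) (harmSum_nonneg N)
  smul_mem' := by
    rintro c a ⟨ha, ha'⟩
    refine ⟨smul_zero (A := 𝕜) c ▸ ha.const_smul c, ?_⟩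
    have := ha'.const_mul ‖c‖
    simpa only [rearrSum_smul ha, mul_div_assoc, mul_zero] using this

variable (𝕜) in
/-- The Gowers space `G`, the predual of the Lorentz sequence space `d({1/n}, 1)`. -/
def GowersSpace : Type _ := gowersSubmodule 𝕜

namespace GowersSpace

instance : AddCommGroup (GowersSpace 𝕜) := inferInstanceAs (AddCommGroup (gowersSubmodule 𝕜))

instance : Module 𝕜 (GowersSpace 𝕜) := inferInstanceAs (Module 𝕜 (gowersSubmodule 𝕜))

/-- The sequence of coordinates of an element of `G`. -/
def coord (a : GowersSpace 𝕜) : ℕ → 𝕜 := (gowersSubmodule 𝕜).subtype a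

/-- The norm of `G`: the supremum (in fact a maximum) over `N ≥ 1` of
`(a*_1 + ⋯ + a*_N) / (1 + 1/2 + ⋯ + 1/N)`. -/
instance : Norm (GowersSpace 𝕜) :=
  ⟨fun a => ⨆ N : ℕ, rearrSum a.coord (N + 1) / harmSum (N + 1)⟩

theorem norm_def (a : GowersSpace 𝕜) :
    ‖a‖ = ⨆ N : ℕ, rearrSum a.coord (N + 1) / harmSum (N + 1) := rfl

theorem bddAbove_ratios (a : GowersSpace 𝕜) :
    BddAbove (Set.range fun N : ℕ => rearrSum a.coord (N + 1) / harmSum (N + 1)) :=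
  ((tendsto_add_atTop_iff_nat 1).2 a.2.2).bddAbove_range

theorem normedSpaceCore : NormedSpace.Core 𝕜 (GowersSpace 𝕜) where
  norm_nonneg a := Real.iSup_nonneg fun N => div_nonneg (rearrSum_nonneg _ _) (harmSum_nonneg _)
  norm_smul c a := by
    rw [norm_def, norm_def, Real.mul_iSup_of_nonneg (norm_nonneg c)]
    congr 1
    funext N
    have h : rearrSum (c • a).coord (N + 1) = ‖c‖ * rearrSum a.coord (N + 1) :=
      rearrSum_smul a.2.1 c _
    rw [h, mul_div_assoc]
  norm_triangle a b := by
    rw [norm_def (a + b)]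
    refine ciSup_le fun N => ?_
    have h : rearrSum (a + b).coord (N + 1) ≤
        rearrSum a.coord (N + 1) + rearrSum b.coord (N + 1) := rearrSum_add_le a.2.1 b.2.1 _
    refine (div_le_div_of_nonneg_right h (harmSum_nonneg _)).trans ?_
    rw [add_div]
    exact add_le_add (le_ciSup (bddAbove_ratios a) N) (le_ciSup (bddAbove_ratios b) N)
  norm_eq_zero_iff a := by
    constructor
    · intro h
      have h0 : rearrSum a.coord (0 + 1) / harmSum (0 + 1) ≤ 0 :=
        (le_ciSup (bddAbove_ratios a) 0).trans (by rw [← norm_def, h])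
      have h1 : rearrSum a.coord 1 ≤ 0 := by simpa [harmSum] using h0
      apply Subtype.ext
      funext i
      have h2 := sum_le_rearrSum a.2.1 {i}
      rw [Finset.sum_singleton, Finset.card_singleton] at h2
      exact norm_le_zero_iff.1 (h2.trans h1)
    · rintro rfl
      have h : (0 : GowersSpace 𝕜).coord = 0 := map_zero _
      simp [norm_def, h, rearrSum_zero]

instance : NormedAddCommGroup (GowersSpace 𝕜) := NormedAddCommGroup.ofCore normedSpaceCore

instance : NormedSpace 𝕜 (GowersSpace 𝕜) := NormedSpace.ofCore normedSpaceCore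

end GowersSpace

end Gowers

end

/-!
Let `Y = L_p(μ)` with `p = 2n / (2n - 1)`, so that the conjugate exponent is `2n`, and let
`u = ∫ x ⊗ y dm` with `m` of total mass `‖u‖_π`. A norming functional of `u` is an operator
`T : X → Y*` of norm one, and comparing the mass of `m` with the value at `u` shows that
`T x y = 1` for `m`-almost every `(x, y)`. All that matters is to confine these `y` to one
finite-dimensional subspace `V` of `Y`: a projection onto `V` then shows that `u ∈ X ⊗ V`
(`INA_subset_algTensors`). Two facts achieve this.

* The norm of `Y` is smooth: a norming functional of `y` is unique. If `T` attains its norm at a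
  pair `(x, y)` and `‖x ± h‖ ≤ 1`, then `T (x ± h)` norms `y` as well, whence `T h = 0`
  (`HasUniqueNorming.apply_eq_zero`). If `X` is LFC, then such `h` fill a subspace of finite
  codimension, up to scaling; in the Gowers space, they include multiples of all but finitely many
  unit vectors. In both cases `T` has finite rank (`IsLFC.finiteDimensional_range`,
  `GowersSpace.finiteDimensional_range`).
* Differentiating the norm of `L_p` identifies the norming functional of `y` as integration against
  `w = |y| ^ (p - 2) * conj y`, an element of `L_{2n}` (`Lp.eq_pairing_dualityMap`). The exponent is
  such that `y = w ^ (n - 1) * conj w ^ n`, a polynomial in `w` and `conj w`. As `T` has finite rank,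
  the functions `w` that represent values of `T` form a finite-dimensional space, and the products
  of `n - 1` of them and `n` conjugates span a finite-dimensional space that contains every `y`
  (`Lp.exists_finiteDimensional_of_range`).

The formula for the norming functional also yields the smoothness of `L_p`
(`Lp.hasUniqueNorming`). No description of the whole dual of `L_p` is needed, and the measure can be
arbitrary.
-/

/-! ### Integrals of elementary tensors in the projective tensor product -/

section ProjectiveLemmas

variable {𝕜 : Type*} [RCLike 𝕜] {X : Type*} [NormedAddCommGroup X] [NormedSpace 𝕜 X]
  {Y : Type*} [NormedAddCommGroup Y] [NormedSpace 𝕜 Y]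

theorem norm_elemTensor_le (x : X) (y : Y) : ‖elemTensor 𝕜 X Y x y‖ ≤ ‖x‖ * ‖y‖ := by
  have h : ‖elemTensor 𝕜 X Y x y‖ = sInf (projReprSums 𝕜 X Y (x ⊗ₜ[𝕜] y)) :=
    UniformSpace.Completion.norm_coe (E := AlgProjTensor 𝕜 X Y) _
  rw [h]
  exact csInf_le (projReprSums_bddBelow _) ⟨[(x, y)], by simp, by simp⟩

/-- A bounded bilinear map factors through the projective tensor product. -/
theorem ProjTensor.exists_lift {Z : Type*} [NormedAddCommGroup Z] [NormedSpace 𝕜 Z]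
    [CompleteSpace Z] (B : X →L[𝕜] Y →L[𝕜] Z) :
    ∃ L : ProjTensor 𝕜 X Y →L[𝕜] Z, ∀ x y, L (elemTensor 𝕜 X Y x y) = B x y := by
  let b : X →ₗ[𝕜] Y →ₗ[𝕜] Z := (ContinuousLinearMap.coeLM 𝕜).comp B.toLinearMap
  let l : X ⊗[𝕜] Y →ₗ[𝕜] Z := TensorProduct.lift b
  have hl : ∀ x y, l (x ⊗ₜ[𝕜] y) = B x y := fun x y => rfl
  have hbound : ∀ u : X ⊗[𝕜] Y, ‖l u‖ ≤ ‖B‖ * sInf (projReprSums 𝕜 X Y u) := by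
    intro u
    rw [← smul_eq_mul, ← Real.sInf_smul_of_nonneg (norm_nonneg B)]
    refine le_csInf ((projReprSums_nonempty u).smul_set) ?_
    rintro _ ⟨_, ⟨s, rfl, rfl⟩, rfl⟩
    dsimp only
    induction s with
    | nil => simp
    | cons q s ih =>
      simp only [List.map_cons, List.sum_cons, map_add, smul_add, hl]
      refine (norm_add_le _ _).trans (add_le_add ?_ ih)
      rw [smul_eq_mul, ← mul_assoc]
      exact B.le_opNorm₂ _ _
  have hdense : DenseRange (UniformSpace.Completion.toComplₗᵢ (𝕜 := 𝕜)
      (E := AlgProjTensor 𝕜 X Y)).toLinearMap := UniformSpace.Completion.denseRange_coe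
  let l' : AlgProjTensor 𝕜 X Y →ₗ[𝕜] Z := l
  refine ⟨l'.extendOfNorm (UniformSpace.Completion.toComplₗᵢ (𝕜 := 𝕜)
      (E := AlgProjTensor 𝕜 X Y)).toLinearMap, fun x y => ?_⟩
  rw [← hl]
  refine LinearMap.extendOfNorm_eq hdense ⟨‖B‖, fun u => (hbound u).trans ?_⟩
    (x ⊗ₜ[𝕜] y : X ⊗[𝕜] Y)
  exact (congrArg (‖B‖ * ·) (UniformSpace.Completion.norm_coe (E := AlgProjTensor 𝕜 X Y) u)).ge

variable (𝕜 X Y) in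
/-- The elementary tensors as a bounded bilinear map. -/
noncomputable def elemTensorL : X →L[𝕜] Y →L[𝕜] ProjTensor 𝕜 X Y :=
  LinearMap.mkContinuous₂ ((TensorProduct.mk 𝕜 X Y).compr₂ (ProjTensor.ofAlg 𝕜 X Y)) 1
    fun x y => (norm_elemTensor_le x y).trans (by rw [one_mul])

theorem elemTensorL_apply (x : X) (y : Y) : elemTensorL 𝕜 X Y x y = elemTensor 𝕜 X Y x y := rfl

theorem sum_elemTensor_mem_algTensors {ι : Type*} (s : Finset ι) (x : ι → X) (y : ι → Y) :
    ∑ i ∈ s, elemTensor 𝕜 X Y (x i) (y i) ∈ algTensors 𝕜 X Y :=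
  ⟨∑ i ∈ s, x i ⊗ₜ[𝕜] y i, map_sum _ _ _⟩

/-- If the second factors lie in a finite-dimensional subspace `V`, then a Bochner integral of
elementary tensors is an algebraic tensor: a projection of `Y` onto `V` induces a bounded operator
on `X ⊗̂_π Y` that takes values in `X ⊗ V` and fixes the integrand. -/
theorem integral_elemTensor_mem_algTensors [CompleteSpace X] [NormedSpace ℝ (ProjTensor 𝕜 X Y)]
    [IsScalarTower ℝ 𝕜 (ProjTensor 𝕜 X Y)]
    {α : Type*} {mα : MeasurableSpace α} {m : Measure α} {f : α → X} {g : α → Y}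
    (hint : Integrable (fun a => elemTensor 𝕜 X Y (f a) (g a)) m)
    (V : Submodule 𝕜 Y) [FiniteDimensional 𝕜 V] (hV : ∀ᵐ a ∂m, g a ∈ V) :
    ∫ a, elemTensor 𝕜 X Y (f a) (g a) ∂m ∈ algTensors 𝕜 X Y := by
  obtain ⟨P, hP⟩ := Submodule.ClosedComplemented.of_finiteDimensional (𝕜 := 𝕜) V
  let b := Module.finBasis 𝕜 V
  let c : Fin (Module.finrank 𝕜 V) → Y →L[𝕜] 𝕜 := fun i =>
    (LinearMap.toContinuousLinearMap (b.coord i)).comp P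
  have hc : ∀ y ∈ V, ∑ i, c i y • (b i : Y) = y := by
    intro y hy
    have h1 : P y = ⟨y, hy⟩ := hP ⟨y, hy⟩
    have h2 := congrArg V.subtype (b.sum_repr ⟨y, hy⟩)
    rw [map_sum] at h2
    simpa [c, h1, -Module.Basis.sum_repr] using h2
  choose C hC using fun i => ProjTensor.exists_lift (𝕜 := 𝕜) (X := X) (Y := Y)
    ((ContinuousLinearMap.smulRightL 𝕜 Y X (c i)))
  have hC' : ∀ i x y, C i (elemTensor 𝕜 X Y x y) = c i y • x := fun i x y => by
    rw [hC]; rfl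
  let Q : ProjTensor 𝕜 X Y →L[𝕜] ProjTensor 𝕜 X Y :=
    ∑ i, ((elemTensorL 𝕜 X Y).flip (b i : Y)).comp (C i)
  have hQ : ∀ u, Q u = ∑ i, elemTensor 𝕜 X Y (C i u) (b i : Y) := fun u => by
    simp [Q, elemTensorL_apply]
  have hfix : ∀ x, ∀ y ∈ V, Q (elemTensor 𝕜 X Y x y) = elemTensor 𝕜 X Y x y := by
    intro x y hy
    rw [hQ]
    conv_rhs => rw [← hc y hy]
    simp only [hC']
    simp only [← elemTensorL_apply, map_smul, map_sum, smul_apply]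
  have key : Q (∫ a, elemTensor 𝕜 X Y (f a) (g a) ∂m) = ∫ a, elemTensor 𝕜 X Y (f a) (g a) ∂m := by
    rw [← Q.integral_comp_comm hint]
    refine integral_congr_ae ?_
    filter_upwards [hV] with a ha using hfix _ _ ha
  rw [← key, hQ]
  exact sum_elemTensor_mem_algTensors _ _ _

/-- A criterion for `INA_π(X ⊗̂_π Y) ⊆ X ⊗ Y`. A norming functional of `u = ∫ x ⊗ y dm` is a
bilinear form of norm one that equals `1` at `m`-almost every `(x, y)`; written as an operator
`T : X → Y*`, it satisfies the hypothesis, which confines almost all `y` to a finite-dimensional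
space. -/
theorem INA_subset_algTensors [CompleteSpace X]
    (h : ∀ T : X →L[𝕜] StrongDual 𝕜 Y, ‖T‖ ≤ 1 → ∃ V : Submodule 𝕜 Y, FiniteDimensional 𝕜 V ∧
      ∀ x y, ‖x‖ ≤ 1 → ‖y‖ ≤ 1 → T x y = 1 → y ∈ V) :
    INA 𝕜 X Y ⊆ algTensors 𝕜 X Y := by
  let _ : NormedSpace ℝ (ProjTensor 𝕜 X Y) := NormedSpace.restrictScalars ℝ 𝕜 _
  have : IsScalarTower ℝ 𝕜 (ProjTensor 𝕜 X Y) := RestrictScalars.isScalarTower ℝ 𝕜 _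
  rintro u ⟨m, hm, hint, hu, hmass⟩
  let _ : MeasurableSpace (Metric.closedBall (0 : X) 1 × Metric.closedBall (0 : Y) 1) := borel _
  by_cases hu0 : u = 0
  · exact ⟨0, by rw [map_zero, hu0]⟩
  obtain ⟨G, hG, hGu⟩ := exists_dual_vector 𝕜 u (norm_ne_zero_iff.2 hu0)
  let T : X →L[𝕜] StrongDual 𝕜 Y :=
    LinearMap.mkContinuous₂
      ((TensorProduct.mk 𝕜 X Y).compr₂ (G.toLinearMap.comp (ProjTensor.ofAlg 𝕜 X Y))) 1
      fun x y => ((G.le_opNorm _).trans (by rw [hG, one_mul]; exact le_rfl)).trans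
        ((norm_elemTensor_le (𝕜 := 𝕜) x y).trans (by rw [one_mul]))
  have hT : ‖T‖ ≤ 1 := LinearMap.mkContinuous₂_norm_le _ zero_le_one _
  have hTG : ∀ x y, T x y = G (elemTensor 𝕜 X Y x y) := fun _ _ => rfl
  have hle : ∀ z : Metric.closedBall (0 : X) 1 × Metric.closedBall (0 : Y) 1,
      ‖G (elemTensor 𝕜 X Y z.1 z.2)‖ ≤ 1 := by
    rintro ⟨⟨x, hx⟩, ⟨y, hy⟩⟩
    rw [mem_closedBall_zero_iff] at hx hy
    refine (G.le_opNorm _).trans ?_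
    rw [hG, one_mul]
    exact (norm_elemTensor_le x y).trans (mul_le_one₀ hx (norm_nonneg _) hy)
  have hintG := G.integrable_comp hint
  -- the integrand below is nonnegative, and its integral is `m.real univ - ‖u‖`
  have hval : ∫ z, (1 - RCLike.re (G (elemTensor 𝕜 X Y (z.1 : X) (z.2 : Y)))) ∂m = 0 := by
    rw [integral_sub (integrable_const _) hintG.re, integral_re hintG,
      G.integral_comp_comm hint, ← hu, hGu]
    simp [hmass]
  have hae := (integral_eq_zero_iff_of_nonneg
    (fun z => sub_nonneg.2 ((RCLike.re_le_norm _).trans (hle z)))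
    ((integrable_const _).sub hintG.re)).1 hval
  obtain ⟨V, hVfin, hV⟩ := h T hT
  rw [hu]
  refine integral_elemTensor_mem_algTensors hint V ?_
  filter_upwards [hae] with z hz
  have hre : RCLike.re (G (elemTensor 𝕜 X Y (z.1 : X) (z.2 : Y))) = 1 := by
    have : 1 - RCLike.re (G (elemTensor 𝕜 X Y (z.1 : X) (z.2 : Y))) = 0 := hz
    linarith
  refine hV z.1 z.2 (mem_closedBall_zero_iff.1 z.1.2) (mem_closedBall_zero_iff.1 z.2.2) ?_
  rw [hTG, ← RCLike.re_eq_self_of_le ((hle z).trans hre.ge), hre, RCLike.ofReal_one]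

end ProjectiveLemmas

/-! ### Norm-attaining operators on LFC spaces into smooth duals -/

section FiniteRank

variable {𝕜 : Type*} [RCLike 𝕜] {X : Type*} [NormedAddCommGroup X] [NormedSpace 𝕜 X]
  {Y : Type*} [NormedAddCommGroup Y] [NormedSpace 𝕜 Y]

variable (𝕜 Y) in
/-- The norm of `Y` is smooth (Gâteaux differentiable off the origin), in its dual form: a point of
the unit ball has at most one norming functional in the dual unit ball. -/
def HasUniqueNorming : Prop :=
  ∀ (g h : StrongDual 𝕜 Y) (y : Y), ‖g‖ ≤ 1 → ‖h‖ ≤ 1 → ‖y‖ ≤ 1 → g y = 1 → h y = 1 → g = h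

theorem RCLike.eq_zero_of_norm_one_add_le {z : 𝕜} (h1 : ‖1 + z‖ ≤ 1) (h2 : ‖1 - z‖ ≤ 1) :
    z = 0 := by
  have h := parallelogram_law_with_norm 𝕜 (1 : 𝕜) z
  rw [norm_one] at h
  have h3 : ‖1 + z‖ * ‖1 + z‖ ≤ 1 := mul_le_one₀ h1 (norm_nonneg _) h1
  have h4 : ‖1 - z‖ * ‖1 - z‖ ≤ 1 := mul_le_one₀ h2 (norm_nonneg _) h2
  have h5 : ‖z‖ * ‖z‖ = 0 := le_antisymm (by linarith) (mul_self_nonneg _)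
  exact norm_eq_zero.1 (mul_self_eq_zero.1 h5)

/-- An operator into the dual of a smooth space that attains its norm at `x` kills every direction
in which the unit ball contains a segment centred at `x`. -/
theorem HasUniqueNorming.apply_eq_zero (hY : HasUniqueNorming 𝕜 Y) {T : X →L[𝕜] StrongDual 𝕜 Y}
    (hT : ‖T‖ ≤ 1) {x h : X} {y : Y} (hy : ‖y‖ ≤ 1) (hxy : T x y = 1) (h1 : ‖x + h‖ ≤ 1)
    (h2 : ‖x - h‖ ≤ 1) : T h = 0 := by
  have hTle : ∀ z : X, ‖z‖ ≤ 1 → ‖T z‖ ≤ 1 := fun z hz =>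
    (T.le_opNorm z).trans (mul_le_one₀ hT (norm_nonneg _) hz)
  have hle : ∀ z : X, ‖z‖ ≤ 1 → ‖T z y‖ ≤ 1 := fun z hz =>
    ((T z).le_opNorm y).trans (mul_le_one₀ (hTle z hz) (norm_nonneg _) hy)
  have hz : T h y = 0 := by
    refine RCLike.eq_zero_of_norm_one_add_le ?_ ?_
    · simpa [hxy] using hle _ h1
    · simpa [hxy] using hle _ h2
  have hx : ‖x‖ ≤ 1 := by
    have h3 : (2 : 𝕜) • x = (x + h) + (x - h) := by rw [two_smul]; abel
    have h4 := norm_add_le (x + h) (x - h)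
    rw [← h3, norm_smul, RCLike.norm_ofNat] at h4
    linarith
  have h5 := hY (T (x + h)) (T x) y (hTle _ h1) (hTle _ hx) hy (by simp [hxy, hz]) hxy
  simpa using h5

theorem finiteDimensional_range_of_ker_le_ker {W Z : Type*} [AddCommGroup W] [Module 𝕜 W]
    [AddCommGroup Z] [Module 𝕜 Z] {E : Type*} [AddCommGroup E] [Module 𝕜 E]
    [FiniteDimensional 𝕜 W] (f : E →ₗ[𝕜] W) (g : E →ₗ[𝕜] Z)
    (h : LinearMap.ker f ≤ LinearMap.ker g) : FiniteDimensional 𝕜 (LinearMap.range g) := by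
  have h1 : FiniteDimensional 𝕜 (E ⧸ LinearMap.ker f) :=
    f.quotKerEquivRange.symm.finiteDimensional
  have h2 : FiniteDimensional 𝕜 (E ⧸ LinearMap.ker g) :=
    Module.Finite.of_surjective (Submodule.factor h) (Submodule.factor_surjective h)
  exact g.quotKerEquivRange.finiteDimensional

/-- Along the common kernel of the functionals on which the norm depends near `x`, the norm is
constant near `x`; a norm-attaining operator therefore vanishes on a subspace of finite
codimension. -/
theorem IsLFC.finiteDimensional_range (hX : IsLFC 𝕜 X) (hY : HasUniqueNorming 𝕜 Y)
    {T : X →L[𝕜] StrongDual 𝕜 Y} (hT : ‖T‖ ≤ 1) {x : X} {y : Y} (hx : ‖x‖ ≤ 1) (hy : ‖y‖ ≤ 1)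
    (hxy : T x y = 1) : FiniteDimensional 𝕜 (LinearMap.range T.toLinearMap) := by
  have hx0 : x ≠ 0 := by
    rintro rfl
    simp at hxy
  obtain ⟨ε, hε, N, f, φ, -, hφ⟩ := hX x hx0
  refine finiteDimensional_range_of_ker_le_ker (LinearMap.pi fun i => (f i).toLinearMap) _ ?_
  intro h hh
  have hfh : ∀ i, f i h = 0 := fun i => congrFun (LinearMap.mem_ker.1 hh) i
  have hconst : ∀ c : 𝕜, ‖c • h‖ < ε → ‖x + c • h‖ ≤ 1 := by
    intro c hc
    rw [hφ (x + c • h) (by rwa [add_sub_cancel_left])]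
    simp only [map_add, map_smul, hfh, smul_zero, add_zero]
    rwa [← hφ x (by simpa using hε)]
  obtain ⟨δ, hδ, hδh⟩ : ∃ δ : ℝ, 0 < δ ∧ δ * ‖h‖ < ε := by
    refine ⟨ε / (‖h‖ + 1), by positivity, ?_⟩
    rw [div_mul_eq_mul_div, div_lt_iff₀ (by positivity)]
    nlinarith [norm_nonneg h]
  have hnorm : ‖(δ : 𝕜) • h‖ < ε := by
    rwa [norm_smul, RCLike.norm_ofReal, abs_of_pos hδ]
  have h0 : T ((δ : 𝕜) • h) = 0 := by
    refine hY.apply_eq_zero hT hy hxy (hconst _ hnorm) ?_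
    rw [sub_eq_add_neg, ← neg_smul]
    exact hconst _ (by rwa [neg_smul, norm_neg])
  rw [map_smul] at h0
  exact (smul_eq_zero.1 h0).resolve_left (RCLike.ofReal_ne_zero.2 hδ.ne')

/-- Near `x`, the norm of `c₀` is the maximum of the moduli of those coordinates in which `x` is
not small. -/
theorem isLFC_zeroAtInfty_nat : IsLFC 𝕜 C₀(ℕ, 𝕜) := by
  have hcoord : ∀ (y : C₀(ℕ, 𝕜)) (i : ℕ), ‖y i‖ ≤ ‖y‖ := fun y i =>
    y.toBCF.norm_coe_le_norm i
  intro x hx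
  have hxpos : 0 < ‖x‖ := norm_pos_iff.2 hx
  have hlim : Tendsto (fun i => ‖x i‖) atTop (𝓝 0) := by
    have := x.zero_at_infty'.norm
    rw [norm_zero, cocompact_eq_cofinite, Nat.cofinite_eq_atTop] at this
    exact this
  obtain ⟨N, hN⟩ := eventually_atTop.1 (hlim.eventually_lt_const (half_pos hxpos))
  refine ⟨‖x‖ / 4, by positivity, N, fun i => LinearMap.mkContinuous
    { toFun := fun y => y (i : ℕ), map_add' := fun _ _ => rfl, map_smul' := fun _ _ => rfl } 1
    (fun y => by simpa using hcoord y i), fun v => ‖v‖, continuous_norm, fun y hy => ?_⟩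
  apply le_antisymm
  · by_contra! hlt
    have h1 : ‖x‖ ≤ ‖y‖ + ‖y - x‖ := by
      simpa [norm_sub_rev] using norm_add_le y (x - y)
    have h2 : ‖y‖ ≤ max (‖fun i : Fin N => y i‖) (3 / 4 * ‖x‖) := by
      refine (BoundedContinuousFunction.norm_le (f := y.toBCF)
        (le_max_of_le_left (norm_nonneg _))).2 fun i => ?_
      rcases lt_or_ge i N with hi | hi
      · exact le_max_of_le_left (norm_le_pi_norm (fun i : Fin N => y i) ⟨i, hi⟩)
      · refine le_max_of_le_right ?_
        have h3 := hcoord (y - x) i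
        have h4 : ‖y i‖ ≤ ‖x i‖ + ‖(y - x) i‖ := by
          simpa using norm_add_le (x i) ((y - x) i)
        have h5 := hN i hi
        change ‖y i‖ ≤ _
        linarith
    rcases le_max_iff.1 h2 with h | h
    · exact absurd h (not_le.2 hlt)
    · linarith
  · exact (pi_norm_le_iff_of_nonneg (norm_nonneg y)).2 fun i => hcoord y i

end FiniteRank

/-! ### The Gowers space -/

section GowersLemmas

variable {𝕜 : Type*} [RCLike 𝕜]

theorem harmSum_succ (N : ℕ) : harmSum (N + 1) = harmSum N + 1 / ((N : ℝ) + 1) :=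
  Finset.sum_range_succ _ _

theorem harmSum_mono : Monotone harmSum :=
  monotone_nat_of_le_succ fun N => by
    rw [harmSum_succ]
    exact le_add_of_nonneg_right (by positivity)

theorem one_le_harmSum {N : ℕ} (hN : 1 ≤ N) : 1 ≤ harmSum N := by
  have h : harmSum 1 = 1 := by simp [harmSum]
  exact h ▸ harmSum_mono hN

theorem tendsto_harmSum : Tendsto harmSum atTop atTop :=
  Real.tendsto_sum_range_one_div_nat_succ_atTop

/-- The sums over `N`-element sets bound the decreasing rearrangement: this form of membership in
`G` does not mention the rearrangement. -/
theorem mem_gowersSubmodule_iff {a : ℕ → 𝕜} : a ∈ gowersSubmodule 𝕜 ↔ Tendsto a atTop (𝓝 0) ∧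
    ∀ ε > 0, ∃ N₀ : ℕ, ∀ A : Finset ℕ, N₀ ≤ A.card → ∑ i ∈ A, ‖a i‖ ≤ ε * harmSum A.card := by
  refine and_congr_right fun ha => ⟨fun h ε hε => ?_, fun h => ?_⟩
  · obtain ⟨N₀, hN₀⟩ := eventually_atTop.1 (h.eventually_lt_const hε)
    refine ⟨max N₀ 1, fun A hA => (sum_le_rearrSum ha A).trans ?_⟩
    have hpos := one_le_harmSum ((le_max_right _ _).trans hA)
    exact ((div_lt_iff₀ (by linarith)).1 (hN₀ _ ((le_max_left _ _).trans hA))).le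
  · rw [Metric.tendsto_atTop]
    intro ε hε
    obtain ⟨N₀, hN₀⟩ := h (ε / 2) (half_pos hε)
    refine ⟨max N₀ 1, fun N hN => ?_⟩
    obtain ⟨A, hA, hsum, -⟩ := exists_top_set ha N
    have hpos := one_le_harmSum ((le_max_right _ _).trans hN)
    have h1 := hN₀ A (by rw [hA]; exact (le_max_left _ _).trans hN)
    rw [dist_zero_right, Real.norm_of_nonneg
      (div_nonneg (rearrSum_nonneg _ _) (harmSum_nonneg _)), div_lt_iff₀ (by linarith), hsum]
    rw [hA] at h1
    nlinarith

namespace GowersSpace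

theorem coord_mem (a : GowersSpace 𝕜) : a.coord ∈ gowersSubmodule 𝕜 := a.2

theorem tendsto_coord (a : GowersSpace 𝕜) : Tendsto a.coord atTop (𝓝 0) := a.2.1

theorem norm_le_iff {a : GowersSpace 𝕜} {r : ℝ} :
    ‖a‖ ≤ r ↔ 0 ≤ r ∧ ∀ A : Finset ℕ, ∑ i ∈ A, ‖a.coord i‖ ≤ r * harmSum A.card := by
  have hpos : ∀ N, 0 < harmSum (N + 1) := fun N =>
    zero_lt_one.trans_le (one_le_harmSum (Nat.succ_pos N))
  constructor
  · intro h
    refine ⟨(norm_nonneg a).trans h, fun A => ?_⟩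
    rcases hA : A.card with _ | N
    · simp [Finset.card_eq_zero.1 hA, harmSum]
    · rw [← hA]
      refine (sum_le_rearrSum a.tendsto_coord A).trans ?_
      rw [hA, ← div_le_iff₀ (hpos N)]
      exact (le_ciSup (bddAbove_ratios a) N).trans h
  · rintro ⟨-, h⟩
    rw [norm_def]
    refine ciSup_le fun N => ?_
    obtain ⟨A, hA, hsum, -⟩ := exists_top_set a.tendsto_coord (N + 1)
    rw [div_le_iff₀ (hpos N), hsum, ← hA]
    exact h A

theorem norm_coord_le (a : GowersSpace 𝕜) (i : ℕ) : ‖a.coord i‖ ≤ ‖a‖ := by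
  simpa [harmSum] using (norm_le_iff.1 (le_refl ‖a‖)).2 {i}

theorem coord_add (a b : GowersSpace 𝕜) (i : ℕ) : (a + b).coord i = a.coord i + b.coord i := rfl

theorem coord_sub (a b : GowersSpace 𝕜) (i : ℕ) : (a - b).coord i = a.coord i - b.coord i := rfl

theorem coord_smul (c : 𝕜) (a : GowersSpace 𝕜) (i : ℕ) : (c • a).coord i = c * a.coord i := rfl

theorem coord_sum {ι : Type*} (s : Finset ι) (f : ι → GowersSpace 𝕜) (i : ℕ) :
    (∑ k ∈ s, f k).coord i = ∑ k ∈ s, (f k).coord i := by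
  let L : GowersSpace 𝕜 →ₗ[𝕜] ℕ → 𝕜 := (gowersSubmodule 𝕜).subtype
  exact (congrFun (map_sum L f s) i).trans (Finset.sum_apply i s fun k => (f k).coord)

instance : CompleteSpace (GowersSpace 𝕜) := by
  refine Metric.complete_of_cauchySeq_tendsto fun u hu => ?_
  have hcauchy : ∀ i, CauchySeq fun k => (u k).coord i := by
    intro i
    rw [Metric.cauchySeq_iff'] at hu ⊢
    intro ε hε
    obtain ⟨K, hK⟩ := hu ε hε
    refine ⟨K, fun k hk => lt_of_le_of_lt ?_ (hK k hk)⟩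
    rw [dist_eq_norm, dist_eq_norm, ← coord_sub]
    exact norm_coord_le _ i
  choose a ha using fun i => cauchySeq_tendsto_of_complete (hcauchy i)
  -- the convergence is uniform over all finite sets of indices
  have hunif : ∀ ε > 0, ∃ K, ∀ k ≥ K, ∀ A : Finset ℕ,
      ∑ i ∈ A, ‖(u k).coord i - a i‖ ≤ ε * harmSum A.card := by
    intro ε hε
    obtain ⟨K, hK⟩ := Metric.cauchySeq_iff.1 hu ε hε
    refine ⟨K, fun k hk A => ?_⟩
    have hlim : Tendsto (fun l => ∑ i ∈ A, ‖(u k).coord i - (u l).coord i‖) atTop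
        (𝓝 (∑ i ∈ A, ‖(u k).coord i - a i‖)) :=
      tendsto_finsetSum _ fun i _ => (tendsto_const_nhds.sub (ha i)).norm
    refine le_of_tendsto hlim (eventually_atTop.2 ⟨K, fun l hl => ?_⟩)
    have h1 : ‖u k - u l‖ ≤ ε := by
      rw [← dist_eq_norm]
      exact (hK k hk l hl).le
    exact (norm_le_iff.1 h1).2 A
  have hsplit : ∀ k i, ‖a i‖ ≤ ‖(u k).coord i‖ + ‖(u k).coord i - a i‖ := fun k i => by
    have := norm_sub_le ((u k).coord i) ((u k).coord i - a i)
    rwa [sub_sub_cancel] at this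
  have hmem : a ∈ gowersSubmodule 𝕜 := by
    rw [mem_gowersSubmodule_iff]
    constructor
    · rw [Metric.tendsto_atTop]
      intro ε hε
      obtain ⟨K, hK⟩ := hunif (ε / 2) (half_pos hε)
      obtain ⟨N, hN⟩ := Metric.tendsto_atTop.1 (u K).tendsto_coord (ε / 2) (half_pos hε)
      refine ⟨N, fun i hi => ?_⟩
      have h1 := hN i hi
      have h2 := hK K le_rfl {i}
      rw [dist_zero_right] at h1 ⊢
      simp only [Finset.sum_singleton, Finset.card_singleton, harmSum, Finset.range_one,
        CharP.cast_eq_zero, zero_add, div_one, mul_one] at h2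
      linarith [hsplit K i]
    · intro ε hε
      obtain ⟨K, hK⟩ := hunif (ε / 2) (half_pos hε)
      obtain ⟨N₀, hN₀⟩ := (mem_gowersSubmodule_iff.1 (u K).coord_mem).2 (ε / 2) (half_pos hε)
      refine ⟨N₀, fun A hA => ?_⟩
      have h1 := Finset.sum_le_sum fun i (_ : i ∈ A) => hsplit K i
      rw [Finset.sum_add_distrib] at h1
      linarith [hK K le_rfl A, hN₀ A hA]
  let b : GowersSpace 𝕜 := ⟨a, hmem⟩
  refine ⟨b, Metric.tendsto_atTop.2 fun ε hε => ?_⟩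
  obtain ⟨K, hK⟩ := hunif (ε / 2) (half_pos hε)
  refine ⟨K, fun k hk => lt_of_le_of_lt ?_ (half_lt_self hε)⟩
  rw [dist_eq_norm]
  exact norm_le_iff.2 ⟨(half_pos hε).le, hK k hk⟩

theorem single_mem (i : ℕ) (c : 𝕜) : (Pi.single i c : ℕ → 𝕜) ∈ gowersSubmodule 𝕜 := by
  rw [mem_gowersSubmodule_iff]
  constructor
  · refine tendsto_const_nhds.congr' ?_
    filter_upwards [eventually_gt_atTop i] with j hj
    exact (Pi.single_eq_of_ne (M := fun _ => 𝕜) hj.ne' c).symm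
  · intro ε hε
    obtain ⟨N₀, hN₀⟩ := eventually_atTop.1 (tendsto_harmSum.eventually_ge_atTop (‖c‖ / ε))
    refine ⟨N₀, fun A hA => ?_⟩
    have h1 := hN₀ _ hA
    rw [div_le_iff₀ hε] at h1
    have h2 : ∑ j ∈ A, ‖(Pi.single i c : ℕ → 𝕜) j‖ ≤ ‖c‖ := by
      simp only [Pi.single_apply, apply_ite norm, norm_zero, Finset.sum_ite_eq']
      split_ifs
      exacts [le_rfl, norm_nonneg c]
    linarith

/-- The vector `c eᵢ` of `G`. -/
noncomputable def single (i : ℕ) (c : 𝕜) : GowersSpace 𝕜 := ⟨Pi.single i c, single_mem i c⟩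

theorem coord_single (i : ℕ) (c : 𝕜) (j : ℕ) : (single i c).coord j = if j = i then c else 0 :=
  Pi.single_apply i c j

theorem smul_single (i : ℕ) (c d : 𝕜) : c • single i d = single i (c * d) :=
  Subtype.ext (funext fun j => by
    change (c • single i d).coord j = (single i (c * d)).coord j
    rw [coord_smul, coord_single, coord_single]
    split_ifs <;> simp)

/-- The finitely supported vectors are dense in `G`. -/
theorem tendsto_sum_single (a : GowersSpace 𝕜) :
    Tendsto (fun M => ∑ i ∈ Finset.range M, single i (a.coord i)) atTop (𝓝 a) := by
  rw [Metric.tendsto_atTop]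
  intro ε hε
  obtain ⟨N₀, hN₀⟩ := (mem_gowersSubmodule_iff.1 a.coord_mem).2 (ε / 2) (half_pos hε)
  obtain ⟨M₀, hM₀⟩ := Metric.tendsto_atTop.1 a.tendsto_coord (ε / 2 / (N₀ + 1)) (by positivity)
  refine ⟨M₀, fun M hM => lt_of_le_of_lt ?_ (half_lt_self hε)⟩
  rw [dist_comm, dist_eq_norm, norm_le_iff]
  refine ⟨(half_pos hε).le, fun A => ?_⟩
  have hval : ∀ j, (a - ∑ i ∈ Finset.range M, single i (a.coord i)).coord j =
      if j < M then 0 else a.coord j := by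
    intro j
    rw [coord_sub, coord_sum]
    simp only [coord_single, Finset.sum_ite_eq, Finset.mem_range]
    split_ifs <;> simp
  simp only [hval]
  rcases le_or_gt N₀ A.card with hA | hA
  · refine (Finset.sum_le_sum fun j _ => ?_).trans (hN₀ A hA)
    split_ifs
    exacts [by simp, le_rfl]
  · rcases A.eq_empty_or_nonempty with rfl | hne
    · simp [harmSum]
    have h1 : ∑ j ∈ A, ‖if j < M then 0 else a.coord j‖ ≤ A.card • (ε / 2 / (N₀ + 1)) := by
      refine Finset.sum_le_card_nsmul _ _ _ fun j _ => ?_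
      split_ifs with hj
      · rw [norm_zero]; positivity
      · have := hM₀ j (hM.trans (not_lt.1 hj))
        rw [dist_zero_right] at this
        exact this.le
    have h2 : A.card • (ε / 2 / (N₀ + 1)) ≤ ε / 2 := by
      have h3 : (A.card : ℝ) ≤ N₀ + 1 := by exact_mod_cast hA.le.trans (Nat.le_succ _)
      rw [nsmul_eq_mul, mul_div_assoc', div_le_iff₀ (by positivity), mul_comm]
      exact mul_le_mul_of_nonneg_left h3 (half_pos hε).le
    have h4 := one_le_harmSum (Finset.card_pos.2 hne)
    nlinarith

/-- Far out coordinates of a vector of the unit ball of `G` can be perturbed by a fixed amount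
without leaving the ball. On sets of large cardinality the defining ratios are at most `1 / 2`;
on a set of cardinality `k ≤ N₀` that contains `i`, the new term is at most `1 / N₀ ≤ 1 / k`, the
last term of the harmonic sum. -/
theorem exists_flat {a : GowersSpace 𝕜} (ha : ‖a‖ ≤ 1) :
    ∃ δ > 0, ∃ M : ℕ, ∀ i ≥ M, ∀ c : 𝕜, ‖c‖ ≤ δ → ‖a + single i c‖ ≤ 1 := by
  obtain ⟨N₁, hN₁⟩ := (mem_gowersSubmodule_iff.1 a.coord_mem).2 (1 / 2) one_half_pos
  obtain ⟨N₀, hN₀pos, hN₀⟩ : ∃ N₀ : ℕ, 1 ≤ N₀ ∧ ∀ A : Finset ℕ, N₀ ≤ A.card →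
      ∑ i ∈ A, ‖a.coord i‖ ≤ 1 / 2 * harmSum A.card :=
    ⟨max N₁ 1, le_max_right _ _, fun A hA => hN₁ A ((le_max_left _ _).trans hA)⟩
  have hN₀' : (1 : ℝ) ≤ N₀ := by exact_mod_cast hN₀pos
  have hδ : (0 : ℝ) < 1 / (2 * N₀) := by positivity
  obtain ⟨M, hM⟩ := Metric.tendsto_atTop.1 a.tendsto_coord _ hδ
  refine ⟨1 / (2 * N₀), hδ, M, fun i hi c hc => norm_le_iff.2 ⟨zero_le_one, fun A => ?_⟩⟩
  have ha' := (norm_le_iff.1 ha).2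
  simp only [one_mul] at ha' ⊢
  have hoff : ∀ j ≠ i, (a + single i c).coord j = a.coord j := fun j hj => by
    rw [coord_add, coord_single, if_neg hj, add_zero]
  by_cases hiA : i ∈ A
  · have hcard : (A.erase i).card + 1 = A.card := Finset.card_erase_add_one hiA
    have hsplit : ∀ f : ℕ → ℝ, ∑ j ∈ A, f j = ∑ j ∈ A.erase i, f j + f i := fun f =>
      (Finset.sum_erase_add A f hiA).symm
    have hsum : ∑ j ∈ A.erase i, ‖(a + single i c).coord j‖ =
        ∑ j ∈ A.erase i, ‖a.coord j‖ :=
      Finset.sum_congr rfl fun j hj => by rw [hoff j (Finset.ne_of_mem_erase hj)]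
    have hlast : ‖(a + single i c).coord i‖ ≤ ‖a.coord i‖ + ‖c‖ := by
      rw [coord_add, coord_single, if_pos rfl]
      exact norm_add_le _ _
    have hMi := hM i hi
    rw [dist_zero_right] at hMi
    rw [hsplit, hsum]
    rcases le_total N₀ A.card with hA | hA
    · have h1 := hN₀ A hA
      rw [hsplit] at h1
      have h2 := one_le_harmSum (hN₀pos.trans hA)
      have h3 : 1 / (2 * (N₀ : ℝ)) ≤ 1 / 2 :=
        one_div_le_one_div_of_le two_pos (by linarith)
      linarith
    · have h1 := ha' (A.erase i)
      rw [← hcard, harmSum_succ]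
      have h2 : 1 / (2 * (N₀ : ℝ)) + 1 / (2 * N₀) = 1 / N₀ := by
        field_simp; norm_num
      have h3 : 1 / (N₀ : ℝ) ≤ 1 / (((A.erase i).card : ℝ) + 1) := by
        refine one_div_le_one_div_of_le (by positivity) ?_
        exact_mod_cast hcard.trans_le hA
      linarith
  · refine (Finset.sum_le_sum fun j hj => ?_).trans (ha' A)
    rw [hoff j fun h => hiA (h ▸ hj)]

theorem finiteDimensional_range {Y : Type*} [NormedAddCommGroup Y] [NormedSpace 𝕜 Y]
    (hY : HasUniqueNorming 𝕜 Y) {T : GowersSpace 𝕜 →L[𝕜] StrongDual 𝕜 Y} (hT : ‖T‖ ≤ 1)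
    {x : GowersSpace 𝕜} {y : Y} (hx : ‖x‖ ≤ 1) (hy : ‖y‖ ≤ 1) (hxy : T x y = 1) :
    FiniteDimensional 𝕜 (LinearMap.range T.toLinearMap) := by
  obtain ⟨δ, hδ, M, hM⟩ := exists_flat hx
  have hzero : ∀ i ≥ M, T (single i 1) = 0 := by
    intro i hi
    have hnorm : ‖(δ : 𝕜)‖ ≤ δ := by rw [RCLike.norm_ofReal, abs_of_pos hδ]
    have h0 : T ((δ : 𝕜) • single i 1) = 0 := by
      refine hY.apply_eq_zero hT hy hxy ?_ ?_
      · rw [smul_single, mul_one]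
        exact hM i hi _ hnorm
      · rw [sub_eq_add_neg, ← neg_smul, smul_single, mul_one]
        exact hM i hi _ (by rwa [norm_neg])
    rw [map_smul] at h0
    exact (smul_eq_zero.1 h0).resolve_left (RCLike.ofReal_ne_zero.2 hδ.ne')
  let S := Submodule.span 𝕜 ((fun i => T (single i 1)) '' (Set.Iio M))
  have hSfin : FiniteDimensional 𝕜 S :=
    FiniteDimensional.span_of_finite 𝕜 ((Set.finite_Iio M).image _)
  have hle : LinearMap.range T.toLinearMap ≤ S := by
    rintro _ ⟨a, rfl⟩
    have hlim : Tendsto (fun K => T (∑ i ∈ Finset.range K, single i (a.coord i))) atTop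
        (𝓝 (T a)) := (T.continuous.tendsto a).comp (tendsto_sum_single a)
    refine S.closed_of_finiteDimensional.mem_of_tendsto hlim (Eventually.of_forall fun K => ?_)
    rw [map_sum]
    refine S.sum_mem fun i _ => ?_
    have h1 : single i (a.coord i) = a.coord i • single i 1 := by rw [smul_single, mul_one]
    rw [h1, map_smul]
    refine S.smul_mem _ ?_
    rcases lt_or_ge i M with hi | hi
    · exact Submodule.subset_span ⟨i, hi, rfl⟩
    · rw [hzero i hi]
      exact S.zero_mem
  exact Submodule.finiteDimensional_of_le hle

end GowersSpace

end GowersLemmas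

/-! ### Norming functionals on `L_p` -/

section LpLemmas

open scoped ComplexConjugate

variable {𝕜 : Type*} [RCLike 𝕜]

theorem hasDerivAt_norm_add_smul_rpow {r : ℝ} (hr : 1 < r) (a b : 𝕜) (t : ℝ) :
    HasDerivAt (fun t : ℝ => ‖a + (t : 𝕜) * b‖ ^ r)
      (r * ‖a + (t : 𝕜) * b‖ ^ (r - 2) * RCLike.re (conj (a + (t : 𝕜) * b) * b)) t := by
  have h1 : HasDerivAt (fun t : ℝ => a + (t : 𝕜) * b) b t := by
    have h2 : HasDerivAt (fun t : ℝ => a + t • b) b t := by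
      simpa using ((hasDerivAt_id t).smul_const b).const_add a
    simpa only [RCLike.real_smul_eq_coe_mul] using h2
  have h3 := (hasFDerivAt_norm_rpow (a + (t : 𝕜) * b) hr).comp_hasDerivAt t h1
  refine h3.congr_deriv ?_
  change r * ‖a + (t : 𝕜) * b‖ ^ (r - 2) * inner ℝ (a + (t : 𝕜) * b) b = _
  rw [show inner ℝ (a + (t : 𝕜) * b) b = RCLike.re (b * conj (a + (t : 𝕜) * b)) from rfl,
    mul_comm b]

theorem norm_rpow_sub_two_mul {r : ℝ} (hr : 1 < r) (a : 𝕜) :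
    ‖a‖ ^ (r - 2) * ‖a‖ = ‖a‖ ^ (r - 1) := by
  rw [← Real.rpow_add_one' (norm_nonneg a) (by linarith)]
  congr 1
  ring

theorem abs_deriv_norm_add_smul_rpow_le {r : ℝ} (hr : 1 < r) (a b : 𝕜) {t : ℝ} (ht : |t| ≤ 1) :
    ‖r * ‖a + (t : 𝕜) * b‖ ^ (r - 2) * RCLike.re (conj (a + (t : 𝕜) * b) * b)‖ ≤
      r * ‖‖a‖ + ‖b‖‖ ^ r := by
  have h1 : ‖a + (t : 𝕜) * b‖ ≤ ‖a‖ + ‖b‖ := by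
    refine (norm_add_le _ _).trans (add_le_add_right ?_ _)
    rw [norm_mul, RCLike.norm_ofReal]
    exact mul_le_of_le_one_left (norm_nonneg b) ht
  set c := a + (t : 𝕜) * b
  have h2 : |RCLike.re (conj c * b)| ≤ ‖c‖ * ‖b‖ := by
    refine (RCLike.abs_re_le_norm _).trans ?_
    rw [norm_mul, RCLike.norm_conj]
  have hab : 0 ≤ ‖a‖ + ‖b‖ := by positivity
  have h3 : ‖c‖ ^ (r - 1) ≤ (‖a‖ + ‖b‖) ^ (r - 1) :=
    Real.rpow_le_rpow (norm_nonneg _) h1 (by linarith)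
  have h4 : (‖a‖ + ‖b‖) ^ (r - 1) * (‖a‖ + ‖b‖) = (‖a‖ + ‖b‖) ^ r := by
    rw [← Real.rpow_add_one' hab (by linarith), sub_add_cancel]
  rw [norm_mul, Real.norm_eq_abs (RCLike.re _), Real.norm_of_nonneg (r := ‖a‖ + ‖b‖) hab,
    Real.norm_of_nonneg (r := r * _) (by positivity)]
  calc r * ‖c‖ ^ (r - 2) * |RCLike.re (conj c * b)|
      ≤ r * ‖c‖ ^ (r - 2) * (‖c‖ * ‖b‖) := mul_le_mul_of_nonneg_left h2 (by positivity)
    _ = r * (‖c‖ ^ (r - 1) * ‖b‖) := by rw [← norm_rpow_sub_two_mul hr]; ring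
    _ ≤ r * ((‖a‖ + ‖b‖) ^ (r - 1) * (‖a‖ + ‖b‖)) := by
        refine mul_le_mul_of_nonneg_left ?_ (by linarith)
        exact mul_le_mul h3 (by linarith [norm_nonneg a]) (norm_nonneg b) (by positivity)
    _ = r * (‖a‖ + ‖b‖) ^ r := by rw [h4]

variable {Ω : Type*} [MeasurableSpace Ω] {μ : Measure Ω} {r q : ℝ}

theorem Lp.norm_rpow_eq_integral (hr : 0 < r) (y : Lp 𝕜 (ENNReal.ofReal r) μ) :
    ‖y‖ ^ r = ∫ x, ‖y x‖ ^ r ∂μ := by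
  have hnn : 0 ≤ ∫ x, ‖y x‖ ^ r ∂μ := integral_nonneg fun x => by positivity
  rw [Lp.norm_def, (Lp.memLp y).eLpNorm_eq_integral_rpow_norm (by simpa using hr)
    ENNReal.ofReal_ne_top, ENNReal.toReal_ofReal hr.le,
    ENNReal.toReal_ofReal (Real.rpow_nonneg hnn _), Real.rpow_inv_rpow hnn hr.ne']

theorem Lp.integrable_norm_rpow (hr : 0 < r) (y : Lp 𝕜 (ENNReal.ofReal r) μ) :
    Integrable (fun x => ‖y x‖ ^ r) μ := by
  have := (Lp.memLp y).integrable_norm_rpow (by simpa using hr) ENNReal.ofReal_ne_top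
  rwa [ENNReal.toReal_ofReal hr.le] at this

/-- The `r`-th power of the norm of `L_r` is differentiable along lines. -/
theorem Lp.hasDerivAt_norm_rpow (hr : 1 < r) (y v : Lp 𝕜 (ENNReal.ofReal r) μ) :
    HasDerivAt (fun t : ℝ => ‖y + (t : 𝕜) • v‖ ^ r)
      (∫ x, r * ‖y x‖ ^ (r - 2) * RCLike.re (conj (y x) * v x) ∂μ) 0 := by
  have hr0 : 0 < r := by linarith
  have hfun : ∀ t : ℝ, ‖y + (t : 𝕜) • v‖ ^ r = ∫ x, ‖y x + (t : 𝕜) * v x‖ ^ r ∂μ := by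
    intro t
    rw [Lp.norm_rpow_eq_integral hr0]
    refine integral_congr_ae ?_
    filter_upwards [Lp.coeFn_add y ((t : 𝕜) • v), Lp.coeFn_smul (t : 𝕜) v] with x h1 h2
    rw [h1, Pi.add_apply, h2, Pi.smul_apply, smul_eq_mul]
  simp only [hfun]
  have hy := Lp.aestronglyMeasurable y
  have hv := Lp.aestronglyMeasurable v
  have hmeas : ∀ t : ℝ, AEStronglyMeasurable (fun x => y x + (t : 𝕜) * v x) μ := fun t =>
    hy.add (hv.const_mul _)
  have hbound : Integrable (fun x => r * ‖‖y x‖ + ‖v x‖‖ ^ r) μ := by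
    have h1 := ((Lp.memLp y).norm.add (Lp.memLp v).norm).integrable_norm_rpow
      (by simpa using hr0) ENNReal.ofReal_ne_top
    rw [ENNReal.toReal_ofReal hr0.le] at h1
    exact h1.const_mul r
  have key := (hasDerivAt_integral_of_dominated_loc_of_deriv_le (𝕜 := ℝ) (μ := μ) (x₀ := (0 : ℝ))
    (F := fun (t : ℝ) x => ‖y x + (t : 𝕜) * v x‖ ^ r)
    (F' := fun (t : ℝ) x => r * ‖y x + (t : 𝕜) * v x‖ ^ (r - 2) *
      RCLike.re (conj (y x + (t : 𝕜) * v x) * v x))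
    (Metric.closedBall_mem_nhds (0 : ℝ) zero_lt_one)
    (Eventually.of_forall fun t => ((hmeas t).norm.aemeasurable.pow_const r).aestronglyMeasurable)
    (by simpa using Lp.integrable_norm_rpow hr0 y)
    ((((hmeas 0).norm.aemeasurable.pow_const (r - 2)).const_mul r).mul
      (RCLike.measurable_re.comp_aemeasurable
        ((RCLike.continuous_conj.comp_aestronglyMeasurable (hmeas 0)).mul
          hv).aemeasurable)).aestronglyMeasurable
    (Eventually.of_forall fun x t ht => abs_deriv_norm_add_smul_rpow_le hr (y x) (v x)
      (by simpa using ht))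
    hbound
    (Eventually.of_forall fun x t _ => hasDerivAt_norm_add_smul_rpow hr (y x) (v x) t)).2
  simpa using key

theorem norm_dualityMap_apply_rpow (hrq : r.HolderConjugate q) (a : 𝕜) :
    ‖((‖a‖ ^ (r - 2) : ℝ) : 𝕜) * conj a‖ ^ q = ‖a‖ ^ r := by
  rw [norm_mul, RCLike.norm_ofReal, abs_of_nonneg (by positivity), RCLike.norm_conj,
    norm_rpow_sub_two_mul hrq.lt, ← Real.rpow_mul (norm_nonneg a), hrq.sub_one_mul_conj]

theorem memLp_dualityMap (hrq : r.HolderConjugate q) (y : Lp 𝕜 (ENNReal.ofReal r) μ) :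
    MemLp (fun x => ((‖y x‖ ^ (r - 2) : ℝ) : 𝕜) * conj (y x)) (ENNReal.ofReal q) μ := by
  have hy := Lp.aestronglyMeasurable y
  have hmeas : AEStronglyMeasurable (fun x => ((‖y x‖ ^ (r - 2) : ℝ) : 𝕜) * conj (y x)) μ :=
    (RCLike.continuous_ofReal.comp_aestronglyMeasurable
      (hy.norm.aemeasurable.pow_const (r - 2)).aestronglyMeasurable).mul
      (RCLike.continuous_conj.comp_aestronglyMeasurable hy)
  refine (integrable_norm_rpow_iff hmeas (by simpa using hrq.symm.pos)
    ENNReal.ofReal_ne_top).1 ?_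
  rw [ENNReal.toReal_ofReal hrq.symm.pos.le]
  simp only [norm_dualityMap_apply_rpow hrq]
  exact Lp.integrable_norm_rpow hrq.pos y

/-- The duality map `y ↦ |y| ^ (r - 2) * conj y` from `L_r` to `L_q`, for conjugate exponents. -/
noncomputable def Lp.dualityMap (hrq : r.HolderConjugate q) (y : Lp 𝕜 (ENNReal.ofReal r) μ) :
    Lp 𝕜 (ENNReal.ofReal q) μ :=
  (memLp_dualityMap hrq y).toLp

theorem Lp.coeFn_dualityMap (hrq : r.HolderConjugate q) (y : Lp 𝕜 (ENNReal.ofReal r) μ) :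
    Lp.dualityMap hrq y =ᵐ[μ] fun x => ((‖y x‖ ^ (r - 2) : ℝ) : 𝕜) * conj (y x) :=
  MemLp.coeFn_toLp _

theorem Lp.integrable_mul [ENNReal.HolderConjugate (ENNReal.ofReal q) (ENNReal.ofReal r)]
    (w : Lp 𝕜 (ENNReal.ofReal q) μ)
    (v : Lp 𝕜 (ENNReal.ofReal r) μ) :
    Integrable (fun x => w x * v x) μ :=
  memLp_one_iff_integrable.1
    ((ContinuousLinearMap.mul 𝕜 𝕜).memLp_of_bilin 1 (Lp.memLp w) (Lp.memLp v))

variable [Fact (1 ≤ ENNReal.ofReal r)] [Fact (1 ≤ ENNReal.ofReal q)]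
  [ENNReal.HolderConjugate (ENNReal.ofReal q) (ENNReal.ofReal r)]

variable (𝕜 μ r q) in
/-- The pairing `⟨w, v⟩ = ∫ w v dμ`, as an operator from `L_q` to the dual of `L_r`. -/
noncomputable def Lp.pairing :
    Lp 𝕜 (ENNReal.ofReal q) μ →L[𝕜] StrongDual 𝕜 (Lp 𝕜 (ENNReal.ofReal r) μ) :=
  (ContinuousLinearMap.mul 𝕜 𝕜).lpPairing μ (ENNReal.ofReal q) (ENNReal.ofReal r)

theorem Lp.pairing_apply (w : Lp 𝕜 (ENNReal.ofReal q) μ) (v : Lp 𝕜 (ENNReal.ofReal r) μ) :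
    Lp.pairing 𝕜 μ r q w v = ∫ x, w x * v x ∂μ :=
  ContinuousLinearMap.lpPairing_eq_integral _ _ _

/-- A functional in the unit ball of the dual of `L_r` that attains the value `1` at a point `y` of
the unit ball is integration against `|y| ^ (r - 2) * conj y`. Indeed, its real part is the
derivative of the norm at `y`: `‖y + t v‖ ≥ 1 + t Re g(v)`, with equality at `t = 0`. -/
theorem Lp.eq_pairing_dualityMap (hrq : r.HolderConjugate q)
    {g : StrongDual 𝕜 (Lp 𝕜 (ENNReal.ofReal r) μ)} {y : Lp 𝕜 (ENNReal.ofReal r) μ}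
    (hg : ‖g‖ ≤ 1) (hy : ‖y‖ ≤ 1) (hgy : g y = 1) :
    g = Lp.pairing 𝕜 μ r q (Lp.dualityMap hrq y) := by
  have hle : ∀ v, ‖g v‖ ≤ ‖v‖ := fun v =>
    (g.le_opNorm v).trans (mul_le_of_le_one_left (norm_nonneg v) hg)
  have hy1 : ‖y‖ = 1 := le_antisymm hy (by simpa [hgy] using hle y)
  have hre : ∀ v, RCLike.re (g v) =
      ∫ x, ‖y x‖ ^ (r - 2) * RCLike.re (conj (y x) * v x) ∂μ := by
    intro v
    set s := RCLike.re (g v)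
    have hlow : ∀ t : ℝ, 1 + t * s ≤ ‖y + (t : 𝕜) • v‖ := fun t => by
      refine le_trans ?_ ((RCLike.re_le_norm _).trans (hle _))
      simp [hgy, s, RCLike.smul_re]
    have hderiv : HasDerivAt (fun t : ℝ => ‖y + (t : 𝕜) • v‖ ^ r - (1 + r * (t * s)))
        ((∫ x, r * ‖y x‖ ^ (r - 2) * RCLike.re (conj (y x) * v x) ∂μ) - r * s) 0 := by
      refine (Lp.hasDerivAt_norm_rpow hrq.lt y v).sub ?_
      simpa using ((((hasDerivAt_id (0 : ℝ)).mul_const s).const_mul r).const_add 1)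
    have hmin : IsLocalMin (fun t : ℝ => ‖y + (t : 𝕜) • v‖ ^ r - (1 + r * (t * s))) 0 := by
      have hev : ∀ᶠ t : ℝ in 𝓝 0, -1 < t * s := by
        have hc : ContinuousAt (fun t : ℝ => t * s) 0 := by fun_prop
        exact hc.eventually_const_lt (by norm_num)
      filter_upwards [hev] with t ht
      -- Bernoulli's inequality carries the tangent line over to the `r`-th power of the norm
      have h1 := one_add_mul_self_le_rpow_one_add ht.le hrq.lt.le
      have h2 : (1 + t * s) ^ r ≤ ‖y + (t : 𝕜) • v‖ ^ r :=
        Real.rpow_le_rpow (by linarith) (hlow t) hrq.pos.le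
      simp only [RCLike.ofReal_zero, zero_smul, add_zero, hy1, Real.one_rpow, zero_mul, mul_zero,
        sub_self]
      linarith
    have h0 := hmin.hasDerivAt_eq_zero hderiv
    simp only [mul_assoc, integral_const_mul] at h0
    rw [← mul_sub] at h0
    linarith [(mul_eq_zero.1 h0).resolve_left hrq.pos.ne']
  have hre' : ∀ v, RCLike.re ((g - Lp.pairing 𝕜 μ r q (Lp.dualityMap hrq y)) v) = 0 := by
    intro v
    have h1 : RCLike.re (Lp.pairing 𝕜 μ r q (Lp.dualityMap hrq y) v) =
        ∫ x, ‖y x‖ ^ (r - 2) * RCLike.re (conj (y x) * v x) ∂μ := by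
      rw [Lp.pairing_apply, ← integral_re (Lp.integrable_mul _ _)]
      refine integral_congr_ae ?_
      filter_upwards [Lp.coeFn_dualityMap hrq y] with x hx
      rw [hx, mul_assoc, RCLike.re_ofReal_mul]
    rw [sub_apply, map_sub, hre v, h1, sub_self]
  rw [← sub_eq_zero]
  ext v
  -- a functional with vanishing real part vanishes: rotate its value onto the real axis
  have h1 := hre' (conj ((g - Lp.pairing 𝕜 μ r q (Lp.dualityMap hrq y)) v) • v)
  rw [map_smul, smul_eq_mul, RCLike.conj_mul] at h1
  have h2 : ‖(g - Lp.pairing 𝕜 μ r q (Lp.dualityMap hrq y)) v‖ ^ 2 = 0 := by exact_mod_cast h1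
  exact norm_eq_zero.1 (pow_eq_zero_iff two_ne_zero |>.1 h2)

theorem Lp.hasUniqueNorming (hrq : r.HolderConjugate q) :
    HasUniqueNorming 𝕜 (Lp 𝕜 (ENNReal.ofReal r) μ) := fun g h y hg hh hy hgy hhy => by
  rw [Lp.eq_pairing_dualityMap hrq hg hy hgy, Lp.eq_pairing_dualityMap hrq hh hy hhy]

/-- Pairing `w` with its own dual function gives `‖w‖ ^ q`. -/
theorem Lp.pairing_injective (hrq : r.HolderConjugate q) :
    Function.Injective (Lp.pairing 𝕜 μ r q) := by
  rw [injective_iff_map_eq_zero]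
  intro w hw
  have h1 : Lp.pairing 𝕜 μ r q w (Lp.dualityMap hrq.symm w) = ((‖w‖ ^ q : ℝ) : 𝕜) := by
    rw [Lp.pairing_apply, Lp.norm_rpow_eq_integral hrq.symm.pos, ← integral_ofReal]
    refine integral_congr_ae ?_
    filter_upwards [Lp.coeFn_dualityMap hrq.symm w] with x hx
    rw [hx, mul_left_comm, RCLike.mul_conj, ← RCLike.ofReal_pow, ← RCLike.ofReal_mul, pow_two,
      ← mul_assoc, norm_rpow_sub_two_mul hrq.symm.lt,
      ← Real.rpow_add_one' (norm_nonneg _) (by linarith [hrq.symm.lt]), sub_add_cancel]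
  rw [hw, zero_apply, eq_comm, RCLike.ofReal_eq_zero,
    Real.rpow_eq_zero (norm_nonneg w) hrq.symm.pos.ne', norm_eq_zero] at h1
  exact h1

end LpLemmas

/-! ### Finite-dimensional spaces of functions -/

theorem finiteDimensional_comap_of_injective {K E F : Type*} [Field K] [AddCommGroup E]
    [Module K E] [AddCommGroup F] [Module K F] (f : E →ₗ[K] F) (hf : Function.Injective f)
    (R : Submodule K F) [FiniteDimensional K R] : FiniteDimensional K (R.comap f) :=
  Module.Finite.of_injective (f.restrict (p := R.comap f) (q := R) fun _ hw => hw)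
    fun _ _ h => Subtype.ext (hf (congrArg Subtype.val h))

section FiniteDimensionalFunctions

open scoped ComplexConjugate

variable {𝕜 : Type*} [RCLike 𝕜] {Ω : Type*} [MeasurableSpace Ω] {μ : Measure Ω} {p : ℝ≥0∞}

/-- A finite-dimensional space of functions contains the representatives of only a
finite-dimensional space of elements of `L_p`, although its members need not be measurable. -/
theorem exists_finiteDimensional_of_ae_eq (S : Submodule 𝕜 (Ω → 𝕜)) (hS : S.FG) :
    ∃ V : Submodule 𝕜 (Lp 𝕜 p μ), FiniteDimensional 𝕜 V ∧
      ∀ y : Lp 𝕜 p μ, ∀ f ∈ S, y =ᵐ[μ] f → y ∈ V := by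
  have hSfin : FiniteDimensional 𝕜 S := Module.Finite.iff_fg.2 hS
  let S' : Submodule 𝕜 S :=
    { carrier := {f | MemLp (f : Ω → 𝕜) p μ}
      zero_mem' := MemLp.zero'
      add_mem' := fun hf hg => hf.add hg
      smul_mem' := fun c _ hf => hf.const_smul c }
  let L : S' →ₗ[𝕜] Lp 𝕜 p μ :=
    { toFun := fun f => MemLp.toLp (f : Ω → 𝕜) f.2
      map_add' := fun _ _ => rfl
      map_smul' := fun _ _ => rfl }
  refine ⟨LinearMap.range L, inferInstance, fun y f hf hyf => ?_⟩
  have hmem : MemLp f p μ := (memLp_congr_ae hyf).1 (Lp.memLp y)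
  refine ⟨⟨⟨f, hf⟩, hmem⟩, Lp.ext ?_⟩
  exact hmem.coeFn_toLp.trans hyf.symm

/-- A finite-dimensional subspace of `L_p` has its representatives in a finite-dimensional space of
functions. Passing to genuine functions makes products available: they form an algebra. -/
theorem exists_fg_representatives (W : Submodule 𝕜 (Lp 𝕜 p μ)) (hW : W.FG) :
    ∃ S : Submodule 𝕜 (Ω → 𝕜), S.FG ∧ ∀ w ∈ W, ∃ f ∈ S, w =ᵐ[μ] f := by
  obtain ⟨s, rfl⟩ := hW
  refine ⟨Submodule.span 𝕜 ((fun w : Lp 𝕜 p μ => (w : Ω → 𝕜)) '' (s : Set (Lp 𝕜 p μ))),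
    Submodule.fg_span (s.finite_toSet.image _), fun w hw => ?_⟩
  induction hw using Submodule.span_induction with
  | mem w hw => exact ⟨w, Submodule.subset_span ⟨w, hw, rfl⟩, EventuallyEq.rfl⟩
  | zero => exact ⟨0, Submodule.zero_mem _, Lp.coeFn_zero 𝕜 p μ⟩
  | add v w _ _ hv hw =>
    obtain ⟨f, hf, hvf⟩ := hv
    obtain ⟨g, hg, hwg⟩ := hw
    exact ⟨f + g, Submodule.add_mem _ hf hg, (Lp.coeFn_add v w).trans (hvf.add hwg)⟩
  | smul c w _ hw =>
    obtain ⟨f, hf, hwf⟩ := hw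
    exact ⟨c • f, Submodule.smul_mem _ c hf, (Lp.coeFn_smul c w).trans (hwf.const_smul c)⟩

/-- For the exponent `r = 2n / (2n - 1)`, in the form `(r - 1) (2n - 1) = 1`, the inverse of
`a ↦ |a| ^ (r - 2) * conj a` is the polynomial `w ↦ w ^ (n - 1) * conj w ^ n` in `w` and `conj w`. -/
theorem pow_mul_conj_pow_dualityMap {n : ℕ} (hn : 1 ≤ n) {r : ℝ} (hr : 1 < r)
    (hrn : (r - 1) * (2 * n - 1) = 1) (a : 𝕜) :
    (((‖a‖ ^ (r - 2) : ℝ) : 𝕜) * conj a) ^ (n - 1) *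
      (conj (((‖a‖ ^ (r - 2) : ℝ) : 𝕜) * conj a)) ^ n = a := by
  obtain ⟨m, rfl⟩ := Nat.exists_eq_add_of_le' hn
  rcases eq_or_ne a 0 with rfl | ha
  · simp
  have hpos : 0 < ‖a‖ := norm_pos_iff.2 ha
  set ρ : ℝ := ‖a‖ ^ (r - 2) with hρ
  have hsq : (ρ * ‖a‖) ^ (2 * m) * ρ = 1 := by
    rw [hρ, norm_rpow_sub_two_mul hr, ← Real.rpow_mul_natCast hpos.le, ← Real.rpow_add hpos]
    push_cast at hrn ⊢
    rw [show (r - 1) * (2 * m) + (r - 2) = 0 by linarith, Real.rpow_zero]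
  have h1 : ((ρ : 𝕜) * conj a) * conj ((ρ : 𝕜) * conj a) = (((ρ * ‖a‖) ^ 2 : ℝ) : 𝕜) := by
    rw [RCLike.mul_conj, norm_mul, RCLike.norm_conj, RCLike.norm_ofReal,
      abs_of_nonneg (by positivity)]
    push_cast
    rfl
  rw [Nat.add_sub_cancel, pow_succ, ← mul_assoc, ← mul_pow, h1, ← RCLike.ofReal_pow, ← pow_mul,
    map_mul, RCLike.conj_ofReal, RCLike.conj_conj, ← mul_assoc, ← RCLike.ofReal_mul, hsq,
    RCLike.ofReal_one, one_mul]

/-- If an operator into the dual of `L_p`, `p = 2n / (2n - 1)`, has finite rank, then the points of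
the unit ball of `L_p` at which its values attain their norm span a finite-dimensional space: they
are polynomials, of degree `2n - 1`, in the functions of `L_{2n}` that represent those values. -/
theorem Lp.exists_finiteDimensional_of_range {X : Type*} [NormedAddCommGroup X]
    [NormedSpace 𝕜 X] {n : ℕ} (hn : 1 ≤ n) {r q : ℝ} (hrq : r.HolderConjugate q)
    (hrn : (r - 1) * (2 * n - 1) = 1) [Fact (1 ≤ ENNReal.ofReal r)]
    (T : X →L[𝕜] StrongDual 𝕜 (Lp 𝕜 (ENNReal.ofReal r) μ)) (hT : ‖T‖ ≤ 1)
    (hfin : FiniteDimensional 𝕜 (LinearMap.range T.toLinearMap)) :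
    ∃ V : Submodule 𝕜 (Lp 𝕜 (ENNReal.ofReal r) μ), FiniteDimensional 𝕜 V ∧
      ∀ x y, ‖x‖ ≤ 1 → ‖y‖ ≤ 1 → T x y = 1 → y ∈ V := by
  have : Fact (1 ≤ ENNReal.ofReal q) := ⟨ENNReal.one_le_ofReal.2 hrq.symm.lt.le⟩
  have : ENNReal.HolderConjugate (ENNReal.ofReal q) (ENNReal.ofReal r) := hrq.symm.ennrealOfReal
  let Φ := (Lp.pairing 𝕜 μ r q).toLinearMap
  let W := (LinearMap.range T.toLinearMap).comap Φ
  have hWfin : FiniteDimensional 𝕜 W :=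
    finiteDimensional_comap_of_injective Φ (Lp.pairing_injective hrq) _
  obtain ⟨S, hS, hWS⟩ := exists_fg_representatives W (Module.Finite.iff_fg.1 hWfin)
  obtain ⟨V, hV, hmem⟩ := exists_finiteDimensional_of_ae_eq (p := ENNReal.ofReal r) (μ := μ)
    (S ^ (n - 1) * (S.map (starLinearEquiv 𝕜 (A := Ω → 𝕜)).toLinearMap) ^ n)
    ((hS.pow _).mul ((hS.map _).pow _))
  refine ⟨V, hV, fun x y hx hy hxy => ?_⟩
  have hTx : ‖T x‖ ≤ 1 := (T.le_opNorm x).trans (mul_le_one₀ hT (norm_nonneg _) hx)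
  obtain ⟨f, hf, hwf⟩ := hWS (Lp.dualityMap hrq y)
    ⟨x, Lp.eq_pairing_dualityMap hrq hTx hy hxy⟩
  refine hmem y (f ^ (n - 1) * star f ^ n) (Submodule.mul_mem_mul (Submodule.pow_mem_pow _ hf _)
    (Submodule.pow_mem_pow _ (Submodule.mem_map_of_mem hf) _)) ?_
  filter_upwards [hwf, Lp.coeFn_dualityMap hrq y] with ω h1 h2
  rw [Pi.mul_apply, Pi.pow_apply, Pi.pow_apply, Pi.star_apply, ← h1, h2]
  exact (pow_mul_conj_pow_dualityMap hn hrq.lt hrn (y ω)).symm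

/-- Only norm-attaining operators matter: for an operator that does not attain its norm, the
criterion for `INA_π(X ⊗̂_π L_p) ⊆ X ⊗ L_p` is void. -/
theorem INA_Lp_subset_algTensors {X : Type*} [NormedAddCommGroup X] [NormedSpace 𝕜 X]
    [CompleteSpace X] {n : ℕ} (hn : 1 ≤ n) {r q : ℝ} (hrq : r.HolderConjugate q)
    (hrn : (r - 1) * (2 * n - 1) = 1) [Fact (1 ≤ ENNReal.ofReal r)]
    (hX : ∀ T : X →L[𝕜] StrongDual 𝕜 (Lp 𝕜 (ENNReal.ofReal r) μ), ‖T‖ ≤ 1 → ∀ x y, ‖x‖ ≤ 1 →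
      ‖y‖ ≤ 1 → T x y = 1 → FiniteDimensional 𝕜 (LinearMap.range T.toLinearMap)) :
    INA 𝕜 X (Lp 𝕜 (ENNReal.ofReal r) μ) ⊆ algTensors 𝕜 X (Lp 𝕜 (ENNReal.ofReal r) μ) := by
  refine INA_subset_algTensors fun T hT => ?_
  by_cases h : ∃ x y, ‖x‖ ≤ 1 ∧ ‖y‖ ≤ 1 ∧ T x y = 1
  · obtain ⟨x, y, hx, hy, hxy⟩ := h
    exact Lp.exists_finiteDimensional_of_range hn hrq hrn T hT (hX T hT x y hx hy hxy)
  · exact ⟨⊥, inferInstance, fun x y hx hy hxy => absurd ⟨x, y, hx, hy, hxy⟩ h⟩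

end FiniteDimensionalFunctions

/-! ### The inclusion for LFC spaces, `c₀` and the Gowers space -/

theorem mainTheorem6 {𝕜 : Type*} [RCLike 𝕜] {Ω : Type*} [MeasurableSpace Ω] (μ : Measure Ω)
    (n : ℕ) (hn : 1 ≤ n) (p : ℝ≥0∞) [Fact (1 ≤ p)]
    (hp : p = ENNReal.ofReal ((2 * (n : ℝ)) / (2 * (n : ℝ) - 1))) :
    (∀ (X : Type*) [NormedAddCommGroup X] [NormedSpace 𝕜 X] [CompleteSpace X],
      IsLFC 𝕜 X → INA 𝕜 X (Lp 𝕜 p μ) ⊆ algTensors 𝕜 X (Lp 𝕜 p μ)) ∧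
    (IsLFC 𝕜 C₀(ℕ, 𝕜) ∧
      INA 𝕜 C₀(ℕ, 𝕜) (Lp 𝕜 p μ) ⊆ algTensors 𝕜 C₀(ℕ, 𝕜) (Lp 𝕜 p μ)) ∧
    INA 𝕜 (GowersSpace 𝕜) (Lp 𝕜 p μ) ⊆ algTensors 𝕜 (GowersSpace 𝕜) (Lp 𝕜 p μ) := by
  subst hp
  have hn' : (1 : ℝ) ≤ n := by exact_mod_cast hn
  have hpos : (0 : ℝ) < 2 * n - 1 := by linarith
  have hrq : ((2 * (n : ℝ)) / (2 * (n : ℝ) - 1)).HolderConjugate (2 * n) := by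
    rw [Real.holderConjugate_iff]
    refine ⟨(one_lt_div hpos).2 (by linarith), ?_⟩
    field_simp
    ring
  have hrn : ((2 * (n : ℝ)) / (2 * (n : ℝ) - 1) - 1) * (2 * n - 1) = 1 := by
    field_simp
    ring
  have : Fact (1 ≤ ENNReal.ofReal (2 * n)) := ⟨ENNReal.one_le_ofReal.2 hrq.symm.lt.le⟩
  have : ENNReal.HolderConjugate (ENNReal.ofReal (2 * n))
    (ENNReal.ofReal ((2 * (n : ℝ)) / (2 * (n : ℝ) - 1))) := hrq.symm.ennrealOfReal
  have hsmooth := Lp.hasUniqueNorming (𝕜 := 𝕜) (μ := μ) hrq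
  exact ⟨fun X _ _ _ hX => INA_Lp_subset_algTensors hn hrq hrn fun T hT x y hx hy hxy =>
      hX.finiteDimensional_range hsmooth hT hx hy hxy,
    ⟨isLFC_zeroAtInfty_nat, INA_Lp_subset_algTensors hn hrq hrn fun T hT x y hx hy hxy =>
      isLFC_zeroAtInfty_nat.finiteDimensional_range hsmooth hT hx hy hxy⟩,
    INA_Lp_subset_algTensors hn hrq hrn fun T hT x y hx hy hxy =>
      GowersSpace.finiteDimensional_range hsmooth hT hx hy hxy⟩
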